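/- **Setting.** Let $(K,d)$ be a complete metric space. Let $N\subset\mathbb N$ with $1\in N$, let $(K_j)_{j\in N}$ be a partition of $K$ into non-empty Borel sets, let $E$ be an at most countable set, $i:E\to N$ surjective and $t:E\to N$. For every $e\in E$ let $w_e:K_{i(e)}\to K_{t(e)}$ and $p_e:K_{i(e)}\to[0,1]$ be Borel measurable, with $p_e$ not identically $0$ and $\sum_{e\in E,\,i(e)=j}p_e(y)=1$ for all $j\in N$, $y\in K_j$. Extend $p_e$ to $K$ by $0$ and $w_e$ to $K$ arbitrarily. $\mathcal M=(K_{i(e)},w_e,p_e)_{e\in E}$ is called a (countable) Markov system; it is *uniformly continuous* if $w_e|_{K_{i(e)}}$ and $p_e|_{K_{i(e)}}$ are uniformly continuous for every $e\in E$. Put $Uf:=\sum_{e\in E}p_e\cdot f\circ w_e$ for Borel $f\ge 0$, and let $P(\mathcal M)$ be the set of invariant measures, i.e. of Borel probability measures $\mu$ on $K$ with $\int Uf\,d\mu=\int f\,d\mu$ for all bounded Borel $f:K\to[0,\infty)$. *Code space.* Let $\bar E:=E\cup\{\infty\}$ be the one-point compactification of the discrete space $E$, with $i(\infty)=t(\infty)=1$,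 and $\bar\Sigma:=\bar E^{\mathbb Z}$ with the product topology and its Borel $\sigma$-algebra. Let $S$ be the left shift, $(S\sigma)_{n}=\sigma_{n+1}$, let $P_S(\bar\Sigma)$ be the set of $S$-invariant Borel probability measures on $\bar\Sigma$, let $\mathcal F$ be the $\sigma$-algebra generated by the coordinates $\sigma_n$, $n\le 0$, and ${}_1[e]:=\{\sigma:\sigma_1=e\}$. Let $\Sigma_G$ be the set of $\sigma\in\bar\Sigma$ with $\sigma_n\in E$ and $i(\sigma_{n+1})=t(\sigma_n)$ for all $n\in\mathbb Z$, and $T_j:=\{\sigma\in\Sigma_G: t(\sigma_0)=j\}$. *Coding map.* Fix $x_j\in K_j$ for every $j\in N$. Let $D$ be the set of $\sigma\in\Sigma_G$ for which $\lim_{m\to-\infty}w_{\sigma_0}\circ\dots\circ w_{\sigma_m}(x_{i(\sigma_m)})$ exists; let $F(\sigma)$ be this limit for $\sigma\in D$, and $F(\sigma):=x_{t(\sigma_0)}$ for $\sigma\in\bar\Sigma\setminus D$. For $\Lambda\in P_S(\bar\Sigma)$ let $F(\Lambda):=\Lambda\circ F^{-1}$ be the image measure on $K$. *Boundary objects.*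 Let $\mathcal M$ be uniformly continuous. Let $\bar w_e$ be the continuous extension of $w_e|_{K_{i(e)}}$ to $\overline{K_{i(e)}}$ (extended arbitrarily to $K$), let $\bar p_e$ be the continuous extension of $p_e|_{K_{i(e)}}$ to $\overline{K_{i(e)}}$, extended by $0$ to $K$, and $\partial p_e:=\bar p_e\,1_{\overline{K_{i(e)}}\setminus K_{i(e)}}$. Let $$\tilde E(\mathcal M):=\{\Lambda\in P_S(\bar\Sigma):\Lambda(D)=1,\ E_\Lambda(1_{{}_1[e]}|\mathcal F)=\bar p_e\circ F\;1_{T_{i(e)}}\ \Lambda\text{-a.e. for all }e\in E\},$$ $$E_\perp(\mathcal M):=\{\Lambda\in P_S(\bar\Sigma):\Lambda(D)=1,\ E_\Lambda(1_{{}_1[e]}|\mathcal F)=\partial p_e\circ F\;1_{T_{i(e)}}\ \Lambda\text{-a.e. for all }e\in E\}.$$ $\mathcal M$ is called *consistent* if $F(\Lambda)\in P(\mathcal M)$ for all $\Lambda\in\tilde E(\mathcal M)$. For Borel $f:K\to[0,\infty]$ put $Rf:=\sum_{e\in E}\partial p_e\cdot f\circ\bar w_e$, and let $\Omega:=\bigcap_{n\in\mathbb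 N}\{R^n1\ge 1\}$. **Theorem.** Let $\mathcal M$ be uniformly continuous. (i) $\mathcal M$ is consistent if and only if $F(\Lambda)\in P(\mathcal M)$ for all $\Lambda\in E_\perp(\mathcal M)$. (ii) If $(Rf)(F(\sigma))\le(Uf)(F(\sigma))$ for all $\sigma\in F^{-1}(\Omega)$ and all bounded Borel $f:K\to[0,\infty)$, then $\mathcal M$ is consistent. -/

import Mathlib

open Set Filter Topology MeasureTheory
open scoped ENNReal NNReal

/-! ### Code space -/

/-- The alphabet `Ē = E ∪ {∞}` carries the σ-algebra of all its subsets. -/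
instance OnePoint.instMeasurableSpaceTop (E : Type*) : MeasurableSpace (OnePoint E) := ⊤

/-- The code space: bi-infinite sequences over `Ē = E ∪ {∞}`, with the product σ-algebra
(for countable discrete `E` it is the Borel σ-algebra of the product topology, see
`CodeSpace.borel_eq` below). -/
abbrev CodeSpace (E : Type*) : Type _ := ℤ → OnePoint E

namespace CodeSpace

/-- The one-point compactification of a countable discrete space has a countable base. -/
theorem secondCountable_onePoint (E : Type*) [Countable E] [TopologicalSpace E]
    [DiscreteTopology E] : SecondCountableTopology (OnePoint E) := by
  have hb : TopologicalSpace.IsTopologicalBasis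
      ((range fun e : E => ({(e : OnePoint E)} : Set (OnePoint E))) ∪
        range fun s : Finset E => (((↑) : E → OnePoint E) '' (s : Set E))ᶜ) := by
    refine TopologicalSpace.isTopologicalBasis_of_isOpen_of_nhds ?_ ?_
    · rintro u (⟨e, rfl⟩ | ⟨s, rfl⟩)
      · have := OnePoint.isOpen_image_coe.2 (isOpen_discrete ({e} : Set E))
        simpa using this
      · exact OnePoint.isOpen_compl_image_coe.2
          ⟨isClosed_discrete _, s.finite_toSet.isCompact⟩
    · intro a u ha hu
      induction a using OnePoint.rec with
      | infty =>
        have h := (OnePoint.isOpen_iff_of_mem ha).1 hu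
        have hf : (((↑) : E → OnePoint E) ⁻¹' u)ᶜ.Finite := h.2.finite_of_discrete
        refine ⟨_, Or.inr ⟨hf.toFinset, rfl⟩, by simp, ?_⟩
        intro y hy
        induction y using OnePoint.rec with
        | infty => exact ha
        | coe y => by_contra hyu; exact hy ⟨y, by simpa using hyu, rfl⟩
      | coe e => exact ⟨_, Or.inl ⟨e, rfl⟩, rfl, by simpa using ha⟩
  exact hb.secondCountableTopology ((countable_range _).union (countable_range _))

/-- For countable discrete `E`, the σ-algebra used on the code space is the Borel σ-algebra of
the product of the one-point compactification topologies. -/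
theorem borel_eq (E : Type*) [Countable E] [TopologicalSpace E] [DiscreteTopology E] :
    borel (CodeSpace E) = (inferInstance : MeasurableSpace (CodeSpace E)) := by
  have := secondCountable_onePoint E
  have : Countable (OnePoint E) := inferInstanceAs (Countable (Option E))
  have : BorelSpace (OnePoint E) := ⟨by
    refine le_antisymm (fun s _ => ?_) le_top
    let _ : MeasurableSpace (OnePoint E) := borel (OnePoint E)
    have : BorelSpace (OnePoint E) := ⟨rfl⟩
    exact s.to_countable.measurableSet⟩
  exact (Pi.borelSpace (X := fun _ : ℤ => OnePoint E)).measurable_eq.symm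

variable {E : Type*}

/-- The left shift, `(S σ)_{n-1} = σ_n`. -/
def shift (σ : CodeSpace E) : CodeSpace E := fun n => σ (n + 1)

/-- The σ-algebra `𝓕` generated by the coordinates `σ_n`, `n ≤ 0`, i.e. by the cylinder sets
`{σ | σ_m = e_m, …, σ_0 = e_0}`, `m ≤ 0`. -/
abbrev past (E : Type*) : MeasurableSpace (CodeSpace E) :=
  ⨆ n : {n : ℤ // n ≤ 0}, MeasurableSpace.comap (fun σ : CodeSpace E => σ n) ⊤

/-- The indicator function of the cylinder set `{σ | σ_1 = e}`. -/
noncomputable def indOne (e : E) : CodeSpace E → ℝ :=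
  {σ : CodeSpace E | σ 1 = (e : OnePoint E)}.indicator fun _ => 1

/-- Shift-invariant probability measures on the code space. -/
def invariantProb (E : Type*) : Set (Measure (CodeSpace E)) :=
  {Λ | IsProbabilityMeasure Λ ∧ MeasurePreserving shift Λ Λ}

end CodeSpace

/-! ### Markov systems -/

/-- A Markov system on `K` with index set `E`. The maps `w e` are of interest on `cell (i e)` only
(their values elsewhere are arbitrary); the probability functions `p e` are extended by zero. -/
structure MarkovSystem (K E : Type*) [MeasurableSpace K] where
  /-- index set of the partition -/
  N : Set ℕ
  one_mem : 1 ∈ N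
  /-- vertex sets -/
  cell : N → Set K
  cell_measurable : ∀ j, MeasurableSet (cell j)
  cell_nonempty : ∀ j, (cell j).Nonempty
  cell_disjoint : Pairwise fun j k => Disjoint (cell j) (cell k)
  cell_cover : ⋃ j, cell j = univ
  /-- initial vertex -/
  i : E → N
  i_surjective : Function.Surjective i
  /-- terminal vertex -/
  t : E → N
  /-- maps -/
  w : E → K → K
  w_measurable : ∀ e, Measurable fun y : cell (i e) => w e y
  w_mapsTo : ∀ e, MapsTo (w e) (cell (i e)) (cell (t e))
  /-- probability functions -/
  p : E → K → ℝ
  p_measurable : ∀ e, Measurable (p e)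
  p_nonneg : ∀ e y, 0 ≤ p e y
  p_le_one : ∀ e y, p e y ≤ 1
  p_eq_zero : ∀ e y, y ∉ cell (i e) → p e y = 0
  p_pos : ∀ e, ∃ y ∈ cell (i e), 0 < p e y
  p_sum : ∀ j, ∀ y ∈ cell j, HasSum (fun e : {e : E // i e = j} => p e y) 1

namespace MarkovSystem

variable {K E : Type*} [MeasurableSpace K] (M : MarkovSystem K E)

/-- The Markov operator `U f = ∑ₑ pₑ · f ∘ wₑ`. -/
noncomputable def U (f : K → ℝ≥0∞) (y : K) : ℝ≥0∞ :=
  ∑' e, ENNReal.ofReal (M.p e y) * f (M.w e y)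

/-- `P(M)`: the Borel probability measures `μ` with `U* μ = μ`, i.e. `∫ U f dμ = ∫ f dμ` for all
bounded nonnegative Borel functions `f`. -/
def invariantMeasures : Set (Measure K) :=
  {μ | IsProbabilityMeasure μ ∧ ∀ f : K → ℝ≥0, Measurable f → (∃ C, ∀ y, f y ≤ C) →
    ∫⁻ y, M.U (fun z => (f z : ℝ≥0∞)) y ∂μ = ∫⁻ y, (f y : ℝ≥0∞) ∂μ}

/-- `i` extended by `i(∞) = 1`. -/
def iExt (a : OnePoint E) : M.N := a.elim ⟨1, M.one_mem⟩ M.i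

/-- `t` extended by `t(∞) = 1`. -/
def tExt (a : OnePoint E) : M.N := a.elim ⟨1, M.one_mem⟩ M.t

/-- `w` extended by `w_∞ = id`. -/
def wExt (a : OnePoint E) : K → K := a.elim id M.w

/-- The path space `Σ_G`. -/
def pathSpace : Set (CodeSpace E) :=
  {σ | ∀ n : ℤ, M.iExt (σ (n + 1)) = M.tExt (σ n) ∧ σ n ≠ OnePoint.infty}

/-- `T_j`, the set of paths `σ` with `t(σ_0) = j`. -/
def T (j : M.N) : Set (CodeSpace E) := {σ ∈ M.pathSpace | M.tExt (σ 0) = j}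

/-- `w_{σ_0} ∘ w_{σ_{-1}} ∘ … ∘ w_{σ_{-n}}`. -/
def backComp (σ : CodeSpace E) : ℕ → K → K
  | 0 => M.wExt (σ 0)
  | n + 1 => backComp σ n ∘ M.wExt (σ (-((n : ℤ) + 1)))

section Topological

variable [TopologicalSpace K] (x : M.N → K)

/-- The set `D` of paths along which `w_{σ_0} ∘ … ∘ w_{σ_m} (x_{i(σ_m)})` converges
as `m → -∞`. -/
def D : Set (CodeSpace E) :=
  {σ | σ ∈ M.pathSpace ∧
    ∃ y, Tendsto (fun n : ℕ => M.backComp σ n (x (M.iExt (σ (-(n : ℤ)))))) atTop (𝓝 y)}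

open Classical in
/-- The coding map `F`. -/
noncomputable def coding (σ : CodeSpace E) : K :=
  if h : σ ∈ M.D x then h.2.choose else x (M.tExt (σ 0))

/-- The continuous extension of `w_e` from `K_{i(e)}` to its closure
(off the closure the values are irrelevant). -/
noncomputable def wBar (e : E) : K → K := extendFrom (M.cell (M.i e)) (M.w e)

/-- The continuous extension of `p_e` from `K_{i(e)}` to its closure, extended by zero. -/
noncomputable def pBar (e : E) : K → ℝ :=
  (closure (M.cell (M.i e))).indicator (extendFrom (M.cell (M.i e)) (M.p e))

/-- `∂p_e`: the restriction of the extension of `p_e` to `closure K_{i(e)} \ K_{i(e)}`, extended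
by zero. -/
noncomputable def pBdry (e : E) : K → ℝ :=
  (closure (M.cell (M.i e)) \ M.cell (M.i e)).indicator (M.pBar e)

/-- `Ẽ(M)`: the asymptotic states. -/
def asymptoticStates : Set (Measure (CodeSpace E)) :=
  {Λ | Λ ∈ CodeSpace.invariantProb E ∧ Λ (M.D x) = 1 ∧
    ∀ e, condExp (CodeSpace.past E) Λ (CodeSpace.indOne e) =ᵐ[Λ]
      (M.T (M.i e)).indicator fun σ => M.pBar e (M.coding x σ)}

/-- `E_⊥(M)`. -/
def Eperp : Set (Measure (CodeSpace E)) :=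
  {Λ | Λ ∈ CodeSpace.invariantProb E ∧ Λ (M.D x) = 1 ∧
    ∀ e, condExp (CodeSpace.past E) Λ (CodeSpace.indOne e) =ᵐ[Λ]
      (M.T (M.i e)).indicator fun σ => M.pBdry e (M.coding x σ)}

/-- The operator `R f = ∑ₑ ∂pₑ · f ∘ w̄ₑ`. -/
noncomputable def R (f : K → ℝ≥0∞) (y : K) : ℝ≥0∞ :=
  ∑' e, ENNReal.ofReal (M.pBdry e y) * f (M.wBar e y)

/-- `Ω = ⋂ₙ {Rⁿ 1 ≥ 1}`. -/
def Omega : Set K := ⋂ n : ℕ, {y | 1 ≤ (M.R^[n]) (fun _ => 1) y}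

/-- Consistency (meant for uniformly continuous systems): `F(Λ) ∈ P(M)` for every asymptotic
state `Λ`. -/
def IsConsistent : Prop :=
  ∀ Λ ∈ M.asymptoticStates x, Measure.map (M.coding x) Λ ∈ M.invariantMeasures

end Topological

/-- Uniform continuity of a Markov system. -/
def IsUniformlyContinuous [UniformSpace K] : Prop :=
  ∀ e, UniformContinuousOn (M.w e) (M.cell (M.i e)) ∧
    UniformContinuousOn (M.p e) (M.cell (M.i e))

/-- The system is uniformly continuous, and `(R f) ∘ F ≤ (U f) ∘ F` on `F⁻¹(Ω)` for all bounded
nonnegative Borel functions `f`. -/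
def BoundaryDomination [UniformSpace K] (x : M.N → K) : Prop :=
  M.IsUniformlyContinuous ∧
    ∀ f : K → ℝ≥0, Measurable f → (∃ C, ∀ y, f y ≤ C) →
      ∀ σ ∈ M.coding x ⁻¹' M.Omega,
        M.R (fun z => (f z : ℝ≥0∞)) (M.coding x σ) ≤ M.U (fun z => (f z : ℝ≥0∞)) (M.coding x σ)

end MarkovSystem

/-! Along a path in `D` the coded point satisfies F(Sσ) = w̄_e(F(σ)) with e = σ_1, and F(σ) lies in
the closure of K_{t(σ_0)}. Everything depends on whether F(σ) lies in K_{t(σ_0)} itself; call this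
the interior event A. It is determined by the past. It is also shift-invariant up to a null set: a
point of K_{i(e)} is mapped into K_{t(e)}, and a forward invariant set is invariant modulo null sets
for a finite invariant measure.

On A the extensions p̄_e, w̄_e coincide with p_e, w_e, so the one-step formula
`setLIntegral_coding_shift` gives the invariance identity for U with no further assumption. Off A,
p̄_e and ∂p_e agree at F(σ) for the edges leaving t(σ_0), so an asymptotic state conditioned on the
complement of A belongs to E_⊥. Conversely a state in E_⊥ gives A mass zero, hence is an asymptotic
state. This proves (i).

For (ii), let Λ be in E_⊥. The one-step formula bounds the conditional expectation of f∘F∘S by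
(Rf)∘F. Iterating from f = 1 shows that F(Λ) lives on Ω, where R is dominated by U; thus ∫ f∘F ≤ ∫
(Uf)∘F. The same inequality for C - f, together with U1 = 1, forces equality. -/

/-! ### Conditional expectations -/

section ConditionalExpectation

variable {Ω : Type*} {m m0 : MeasurableSpace Ω}

/-- Pull-out property of the conditional probability of `A` for nonnegative functions. -/
theorem setLIntegral_eq_lintegral_condExp_indicator (hm : m ≤ m0) (μ : Measure Ω)
    [IsFiniteMeasure μ] {A : Set Ω} (hA : MeasurableSet A) {g : Ω → ℝ≥0∞}
    (hg : Measurable[m] g) :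
    ∫⁻ ω in A, g ω ∂μ
      = ∫⁻ ω, ENNReal.ofReal (condExp m μ (A.indicator fun _ => (1 : ℝ)) ω) * g ω ∂μ := by
  set q := condExp m μ (A.indicator fun _ => (1 : ℝ)) 
  have hint : Integrable (A.indicator fun _ => (1 : ℝ)) μ :=
    (integrable_const (1 : ℝ)).indicator hA
  have hqm : Measurable fun ω => ENNReal.ofReal (q ω) :=
    (stronglyMeasurable_condExp.measurable.mono hm le_rfl).ennreal_ofReal
  have hq0 : 0 ≤ᵐ[μ] q :=
    condExp_nonneg (ae_of_all _ fun ω => indicator_nonneg (fun _ _ => zero_le_one) ω)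
  -- On m-measurable sets, equality of these two measures is the defining property of the
  -- conditional probability; pulling out `g` is then integration against equal measures.
  have hν : (μ.restrict A).trim hm = (μ.withDensity fun ω => ENNReal.ofReal (q ω)).trim hm := by
    refine @Measure.ext _ m _ _ fun s hs => ?_
    rw [trim_measurableSet_eq hm hs, trim_measurableSet_eq hm hs,
      Measure.restrict_apply (hm s hs), withDensity_apply _ (hm s hs),
      ← ofReal_integral_eq_lintegral_ofReal integrable_condExp.integrableOn
        (ae_restrict_of_ae hq0), setIntegral_condExp hm hint hs,
      setIntegral_indicator hA]
    simp
  rw [← lintegral_trim hm hg, hν, lintegral_trim hm hg,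
    lintegral_withDensity_eq_lintegral_mul _ hqm (hg.mono hm le_rfl)]
  rfl

/-- Conditioning on an event of the conditioning σ-algebra does not change conditional
expectations. -/
theorem condExp_smul_restrict_ae_eq (hm : m ≤ m0) (μ : Measure Ω) [IsFiniteMeasure μ]
    {B : Set Ω} (hB : MeasurableSet[m] B) {c : ℝ≥0∞} (hc : c ≠ ∞) {f : Ω → ℝ}
    (hf : Integrable f μ) :
    condExp m (c • μ.restrict B) f =ᵐ[c • μ.restrict B] condExp m μ f := by
  have : IsFiniteMeasure (c • μ.restrict B) := Measure.smul_finite _ hc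
  symm
  refine ae_eq_condExp_of_forall_setIntegral_eq hm (hf.restrict.smul_measure hc)
    (fun s _ _ => ((integrable_condExp.restrict.smul_measure hc)).integrableOn)
    (fun s hs _ => ?_) stronglyMeasurable_condExp.aestronglyMeasurable
  rw [Measure.restrict_smul, integral_smul_measure, integral_smul_measure,
    Measure.restrict_restrict (hm s hs),
    setIntegral_condExp hm hf (MeasurableSet.inter hs hB)]

end ConditionalExpectation

/-! ### Limits of sequences of measurable maps -/

/-- By completeness, convergence is the Cauchy property, a countable condition on distances.
Measurability of the distances is assumed separately because in a non-separable space it does not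
follow from measurability of the maps. -/
theorem measurableSet_exists_tendsto_of_dist {Ω K : Type*} [MeasurableSpace Ω] [MetricSpace K]
    [CompleteSpace K] {u : ℕ → Ω → K} (hd : ∀ n k, Measurable fun ω => dist (u n ω) (u k ω)) :
    MeasurableSet {ω | ∃ y, Tendsto (fun n => u n ω) atTop (𝓝 y)} := by
  have : {ω | ∃ y, Tendsto (fun n => u n ω) atTop (𝓝 y)} =
      ⋂ k : ℕ, ⋃ n : ℕ, ⋂ l : ℕ, ⋂ _ : n ≤ l,
        {ω | dist (u l ω) (u n ω) < 1 / ((k : ℝ) + 1)} := by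
    ext ω
    have hc : (∃ y, Tendsto (fun n => u n ω) atTop (𝓝 y)) ↔ CauchySeq fun n => u n ω :=
      ⟨fun ⟨_, hy⟩ => hy.cauchySeq, fun h => cauchySeq_tendsto_of_complete h⟩
    simp only [hc, mem_ofPred_eq, mem_iInter, mem_iUnion, Metric.cauchySeq_iff']
    constructor
    · intro h k
      exact h _ (by positivity)
    · intro h ε hε
      obtain ⟨k, hk⟩ := exists_nat_one_div_lt hε
      obtain ⟨n, hn⟩ := h k
      exact ⟨n, fun l hl => (hn l hl).trans hk⟩
  rw [this]
  exact .iInter fun k => .iUnion fun n => .iInter fun l => .iInter fun _ =>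
    measurableSet_lt (hd l n) measurable_const

open Classical in
/-- Pointwise limits, set to a constant where they do not exist, are measurable, without any
separability of the target. -/
theorem measurable_dite_tendsto {Ω K : Type*} [MeasurableSpace Ω] [MetricSpace K]
    [CompleteSpace K] [MeasurableSpace K] [BorelSpace K] {u : ℕ → Ω → K}
    (hu : ∀ n, Measurable (u n)) (hd : ∀ n k, Measurable fun ω => dist (u n ω) (u k ω)) (c : K) :
    Measurable fun ω =>
      if h : ∃ y, Tendsto (fun n => u n ω) atTop (𝓝 y) then h.choose else c := by
  -- Replacing the approximants by `c` off the convergence set makes the sequence converge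
  -- everywhere.
  refine measurable_of_tendsto_metrizable
    (f := fun n ω => if ∃ y, Tendsto (fun n => u n ω) atTop (𝓝 y) then u n ω else c)
    (fun n => (hu n).ite (measurableSet_exists_tendsto_of_dist hd) measurable_const)
    (tendsto_pi_nhds.2 fun ω => ?_)
  by_cases h : ∃ y, Tendsto (fun n => u n ω) atTop (𝓝 y)
  · simpa only [if_pos h, dif_pos h] using h.choose_spec
  · simp only [if_neg h, dif_neg h]
    exact tendsto_const_nhds

/-! ### The past of the code space -/

namespace CodeSpace

variable {E : Type*}

theorem past_le : past E ≤ (inferInstance : MeasurableSpace (CodeSpace E)) :=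
  iSup_le fun n => (measurable_pi_apply (n : ℤ)).comap_le

theorem measurable_past_apply {n : ℤ} (hn : n ≤ 0) :
    Measurable[past E] fun σ : CodeSpace E => σ n := by
  intro s hs
  exact le_iSup (fun n : {n : ℤ // n ≤ 0} =>
    MeasurableSpace.comap (fun σ : CodeSpace E => σ n) ⊤) ⟨n, hn⟩ _ ⟨s, hs, rfl⟩

/-- A map that depends on finitely many past coordinates is measurable. -/
theorem measurable_past_of_dependsOn [Countable E] {β : Type*} [MeasurableSpace β]
    {f : CodeSpace E → β} (n : ℕ)
    (h : ∀ σ τ : CodeSpace E, (∀ k : ℕ, k ≤ n → σ (-(k : ℤ)) = τ (-(k : ℤ))) → f σ = f τ) :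
    Measurable[past E] f := by
  have : Countable (OnePoint E) := inferInstanceAs (Countable (Option E))
  let r : CodeSpace E → (Fin (n + 1) → OnePoint E) := fun σ k => σ (-((k : ℕ) : ℤ))
  -- A right inverse of `r` on the coordinates that matter: for z = -k with k ≤ n the reduction
  -- modulo n + 1 is harmless, and the other values are irrelevant. Then `f` factors through a
  -- countable discrete space.
  let s : (Fin (n + 1) → OnePoint E) → CodeSpace E := fun u z => u (Fin.ofNat (n + 1) (-z).toNat)
  have hr : Measurable[past E] r :=
    @measurable_pi_lambda _ _ _ (past E) _ _ fun k => measurable_past_apply (by simp)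
  have : MeasurableSingletonClass (OnePoint E) := ⟨fun _ => MeasurableSpace.measurableSet_top⟩
  have hfs : f = (f ∘ s) ∘ r := by
    funext σ
    refine h _ _ fun k hk => ?_
    simp [r, s, Nat.mod_eq_of_lt (Nat.lt_succ_of_le hk)]
  rw [hfs]
  exact (measurable_of_countable (f ∘ s)).comp hr

theorem measurableSet_apply_eq (n : ℤ) (e : OnePoint E) :
    MeasurableSet {σ : CodeSpace E | σ n = e} :=
  (measurable_pi_apply n : Measurable fun σ : CodeSpace E => σ n)
    (MeasurableSpace.measurableSet_top (s := ({e} : Set (OnePoint E))))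

theorem integrable_indOne (Λ : Measure (CodeSpace E)) [IsFiniteMeasure Λ] (e : E) :
    Integrable (indOne e) Λ :=
  (integrable_const (1 : ℝ)).indicator (measurableSet_apply_eq 1 _)

end CodeSpace

/-! ### Extension by uniform continuity -/

/-- The trace on `s` of the neighbourhood filter is Cauchy, and uniform continuity on `s` preserves
this. -/
theorem UniformContinuousOn.exists_tendsto_nhdsWithin {α β : Type*} [UniformSpace α]
    [UniformSpace β] [CompleteSpace β] {f : α → β} {s : Set α} (hf : UniformContinuousOn f s)
    {y : α} (hy : y ∈ closure s) : ∃ z, Tendsto f (𝓝[s] y) (𝓝 z) := by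
  have : (𝓝[s] y).NeBot := mem_closure_iff_nhdsWithin_neBot.1 hy
  have hle : 𝓝[s] y ×ˢ 𝓝[s] y ≤ uniformity α ⊓ 𝓟 (s ×ˢ s) :=
    le_inf ((cauchy_nhds (a := y)).mono nhdsWithin_le_nhds).2
      (le_principal_iff.2 (prod_mem_prod self_mem_nhdsWithin self_mem_nhdsWithin))
  exact cauchy_map_iff_exists_tendsto.1 (cauchy_map_iff.2 ⟨this, Tendsto.mono_left hf hle⟩)

theorem UniformContinuousOn.continuousOn_extendFrom_closure {α β : Type*} [UniformSpace α]
    [UniformSpace β] [CompleteSpace β] {f : α → β} {s : Set α} (hf : UniformContinuousOn f s) :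
    ContinuousOn (extendFrom s f) (closure s) :=
  continuousOn_extendFrom subset_rfl fun _ hy => hf.exists_tendsto_nhdsWithin hy

theorem ContinuousOn.extendFrom_eq_of_mem {α β : Type*} [TopologicalSpace α]
    [TopologicalSpace β] [T2Space β] {f : α → β} {s : Set α} (hf : ContinuousOn f s) {y : α}
    (hy : y ∈ s) : extendFrom s f y = f y :=
  extendFrom_eq (subset_closure hy) (hf y hy)

/-- Needed because w_e and w̄_e are controlled only on a cell or its closure; elsewhere the
vanishing weight hides them. -/
theorem Measurable.indicator_comp_of_restrict {α β γ : Type*} [MeasurableSpace α]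
    [MeasurableSpace β] [MeasurableSpace γ] [Zero γ] {f : α → β} {s : Set α}
    (hs : MeasurableSet s) (hf : Measurable fun y : s => f y) {g : β → γ} (hg : Measurable g) :
    Measurable (s.indicator fun y => g (f y)) := by
  refine measurable_of_restrict_of_restrict_compl hs ?_ ?_
  · convert hg.comp hf using 1
    exact funext fun y => indicator_of_mem y.2 _
  · convert (measurable_const : Measurable fun _ : ↥sᶜ => (0 : γ)) using 1
    exact funext fun y => indicator_of_notMem y.2 _

/-! ### The Markov operator and backward compositions along paths -/

namespace MarkovSystem

section Basic

variable {K E : Type*} [MeasurableSpace K] {M : MarkovSystem K E} {x : M.N → K}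

theorem eq_of_mem_cell {j k : M.N} {y : K} (hj : y ∈ M.cell j) (hk : y ∈ M.cell k) : j = k := by
  by_contra h
  exact disjoint_left.1 (M.cell_disjoint h) hj hk

theorem measurable_U [Countable E] {f : K → ℝ≥0∞} (hf : Measurable f) : Measurable (M.U f) := by
  have h : M.U f = fun y => ∑' e, ENNReal.ofReal (M.p e y) *
      (M.cell (M.i e)).indicator (fun y => f (M.w e y)) y := by
    funext y
    refine tsum_congr fun e => ?_
    by_cases hy : y ∈ M.cell (M.i e)
    · rw [indicator_of_mem hy]
    · rw [M.p_eq_zero e y hy]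
      simp
  rw [h]
  exact Measurable.tsum fun e => (M.p_measurable e).ennreal_ofReal.mul
    (Measurable.indicator_comp_of_restrict (M.cell_measurable _) (M.w_measurable e) hf)

theorem U_const (c : ℝ≥0∞) (y : K) : M.U (fun _ => c) y = c := by
  obtain ⟨j, hj⟩ := mem_iUnion.1 (M.cell_cover.symm ▸ mem_univ y : y ∈ ⋃ j, M.cell j)
  have hs := M.p_sum j y hj
  -- The cells are disjoint, so only edges starting at `j` have positive probability at `y`.
  have h0 : (Function.support fun e => ENNReal.ofReal (M.p e y)) ⊆ {e | M.i e = j} := by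
    intro e he
    by_contra h
    exact he (by
      simp only [M.p_eq_zero e y fun hy => h (eq_of_mem_cell hy hj), ENNReal.ofReal_zero])
  have h1 : ∑' e, ENNReal.ofReal (M.p e y) = 1 := by
    rw [← tsum_subtype_eq_of_support_subset h0, ← ENNReal.ofReal_one, ← hs.tsum_eq,
      ENNReal.ofReal_tsum_of_nonneg (fun e => M.p_nonneg _ _) hs.summable]
    rfl
  rw [U, ENNReal.tsum_mul_right, h1, one_mul]

theorem U_add (f g : K → ℝ≥0∞) (y : K) :
    M.U (fun z => f z + g z) y = M.U f y + M.U g y := by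
  simp only [U, mul_add, ENNReal.tsum_add]

theorem backComp_congr {σ τ : CodeSpace E} {n : ℕ}
    (h : ∀ k : ℕ, k ≤ n → σ (-(k : ℤ)) = τ (-(k : ℤ))) : M.backComp σ n = M.backComp τ n := by
  induction n with
  | zero =>
    have := h 0 le_rfl
    simp only [Nat.cast_zero, neg_zero] at this
    simp only [backComp, this]
  | succ n ih =>
    have := h (n + 1) le_rfl
    push_cast at this
    simp only [backComp, this, ih fun k hk => h k (hk.trans n.le_succ)]

theorem wExt_mem {a : OnePoint E} (ha : a ≠ OnePoint.infty) {y : K}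
    (hy : y ∈ M.cell (M.iExt a)) : M.wExt a y ∈ M.cell (M.tExt a) := by
  induction a using OnePoint.rec with
  | infty => exact absurd rfl ha
  | coe e => exact M.w_mapsTo e hy

theorem backComp_mem {σ : CodeSpace E} (hσ : σ ∈ M.pathSpace) (n : ℕ) {y : K}
    (hy : y ∈ M.cell (M.iExt (σ (-(n : ℤ))))) : M.backComp σ n y ∈ M.cell (M.tExt (σ 0)) := by
  induction n generalizing y with
  | zero => exact wExt_mem (hσ 0).2 (by simpa using hy)
  | succ n ih =>
    have h := (hσ (-((n : ℤ) + 1))).1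
    rw [show -((n : ℤ) + 1) + 1 = -(n : ℤ) by ring] at h
    refine ih (y := M.wExt (σ (-((n : ℤ) + 1))) y) ?_
    rw [h]
    exact wExt_mem (hσ _).2 (by exact_mod_cast hy)

/-- The shift adds a letter at the outer end, while the recursion of `backComp` adds one at the
inner end; hence the induction. -/
theorem backComp_shift (σ : CodeSpace E) (n : ℕ) :
    M.backComp (CodeSpace.shift σ) (n + 1) = M.wExt (σ 1) ∘ M.backComp σ n := by
  induction n with
  | zero => simp [backComp, CodeSpace.shift]
  | succ n ih =>
    rw [backComp, ih, backComp, Function.comp_assoc]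
    congr 3

theorem pathSpace_shift {σ : CodeSpace E} (hσ : σ ∈ M.pathSpace) :
    CodeSpace.shift σ ∈ M.pathSpace := fun n => hσ (n + 1)

theorem iExt_one_eq {σ : CodeSpace E} (hσ : σ ∈ M.pathSpace) :
    M.iExt (σ 1) = M.tExt (σ 0) := (hσ 0).1

theorem exists_apply_one_eq {σ : CodeSpace E} (hσ : σ ∈ M.pathSpace) :
    ∃ e : E, σ 1 = (e : OnePoint E) ∧ M.tExt (σ 0) = M.i e := by
  obtain ⟨e, he⟩ := OnePoint.ne_infty_iff_exists.1 (hσ 1).2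
  refine ⟨e, he.symm, ?_⟩
  rw [← iExt_one_eq hσ, ← he]
  rfl

/-- The approximations `w_{σ_0} ∘ … ∘ w_{σ_{-n}} (x_{i(σ_{-n})})` of the coding map. -/
def backPoint (M : MarkovSystem K E) (x : M.N → K) (n : ℕ) (σ : CodeSpace E) : K := M.backComp σ n (x (M.iExt (σ (-(n : ℤ)))))

theorem backPoint_congr {σ τ : CodeSpace E} {n : ℕ}
    (h : ∀ k : ℕ, k ≤ n → σ (-(k : ℤ)) = τ (-(k : ℤ))) :
    M.backPoint x n σ = M.backPoint x n τ := by
  rw [backPoint, backPoint, backComp_congr h, h n le_rfl]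

theorem backPoint_mem (hx : ∀ j, x j ∈ M.cell j) {σ : CodeSpace E} (hσ : σ ∈ M.pathSpace)
    (n : ℕ) : M.backPoint x n σ ∈ M.cell (M.tExt (σ 0)) :=
  backComp_mem hσ n (hx _)

theorem backPoint_shift (σ : CodeSpace E) (n : ℕ) :
    M.backPoint x (n + 1) (CodeSpace.shift σ) = M.wExt (σ 1) (M.backPoint x n σ) := by
  rw [backPoint, backComp_shift, backPoint, Function.comp_apply, CodeSpace.shift]
  congr 5
  push_cast
  ring_nf

end Basic

/-! ### Boundary extensions and the coding map -/

section Metric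

variable {K E : Type*} [MetricSpace K] [MeasurableSpace K] {M : MarkovSystem K E} {x : M.N → K}

theorem pBar_eq (hM : M.IsUniformlyContinuous) {e : E} {y : K} (hy : y ∈ M.cell (M.i e)) :
    M.pBar e y = M.p e y := by
  rw [pBar, indicator_of_mem (subset_closure hy)]
  exact (hM e).2.continuousOn.extendFrom_eq_of_mem hy

theorem wBar_eq (hM : M.IsUniformlyContinuous) {e : E} {y : K} (hy : y ∈ M.cell (M.i e)) :
    M.wBar e y = M.w e y :=
  (hM e).1.continuousOn.extendFrom_eq_of_mem hy

theorem pBdry_eq_zero {e : E} {y : K} (hy : y ∈ M.cell (M.i e)) : M.pBdry e y = 0 :=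
  indicator_of_notMem (fun h => h.2 hy) _

theorem pBdry_eq_pBar {e : E} {y : K} (hy : y ∉ M.cell (M.i e)) : M.pBdry e y = M.pBar e y := by
  by_cases hc : y ∈ closure (M.cell (M.i e))
  · have h : y ∈ closure (M.cell (M.i e)) \ M.cell (M.i e) := ⟨hc, hy⟩
    exact indicator_of_mem h (M.pBar e)
  · exact (indicator_of_notMem (fun h => hc h.1) (M.pBar e)).trans
      (indicator_of_notMem hc (extendFrom (M.cell (M.i e)) (M.p e))).symm

theorem measurable_dist_backPoint [Countable E] (n k : ℕ) :
    Measurable[CodeSpace.past E] fun σ => dist (M.backPoint x n σ) (M.backPoint x k σ) := by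
  refine CodeSpace.measurable_past_of_dependsOn (max n k) fun σ τ h => ?_
  rw [backPoint_congr (σ := σ) (τ := τ) fun l hl => h l (hl.trans (le_max_left _ _)),
    backPoint_congr (σ := σ) (τ := τ) fun l hl => h l (hl.trans (le_max_right _ _))]

theorem measurableSet_D [CompleteSpace K] [Countable E] : MeasurableSet (M.D x) := by
  have h1 : MeasurableSet {σ : CodeSpace E | ∃ y,
      Tendsto (fun n => M.backPoint x n σ) atTop (𝓝 y)} :=
    CodeSpace.past_le _ (@measurableSet_exists_tendsto_of_dist _ _ (CodeSpace.past E) _ _ _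
      measurable_dist_backPoint)
  refine MeasurableSet.inter ?_ h1
  have : M.pathSpace = ⋂ n : ℤ, ({σ | M.iExt (σ (n + 1)) = M.tExt (σ n)} ∩
      {σ : CodeSpace E | σ n = OnePoint.infty}ᶜ) := by
    ext σ
    simp only [mem_iInter]
    rfl
  rw [this]
  refine .iInter fun n => .inter (measurableSet_eq_fun ?_ ?_)
    (CodeSpace.measurableSet_apply_eq _ _).compl
  · have h : Measurable M.iExt := measurable_from_top
    exact h.comp (measurable_pi_apply (n + 1))
  · have h : Measurable M.tExt := measurable_from_top
    exact h.comp (measurable_pi_apply n)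

theorem tendsto_coding {σ : CodeSpace E} (hσ : σ ∈ M.D x) :
    Tendsto (fun n => M.backPoint x n σ) atTop (𝓝 (M.coding x σ)) := by
  rw [coding, dif_pos hσ]
  exact hσ.2.choose_spec

theorem coding_mem_closure (hx : ∀ j, x j ∈ M.cell j) {σ : CodeSpace E} (hσ : σ ∈ M.D x) :
    M.coding x σ ∈ closure (M.cell (M.tExt (σ 0))) :=
  mem_closure_of_tendsto (tendsto_coding hσ) (Eventually.of_forall (backPoint_mem hx hσ.1))

open Classical in
/-- A version of the coding map that depends on the past only. -/
noncomputable def pastCoding (M : MarkovSystem K E) (x : M.N → K) (σ : CodeSpace E) : K :=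
  if h : ∃ y, Tendsto (fun n => M.backPoint x n σ) atTop (𝓝 y) then h.choose
  else x ⟨1, M.one_mem⟩

theorem pastCoding_eq {σ : CodeSpace E} (hσ : σ ∈ M.D x) :
    M.pastCoding x σ = M.coding x σ := by
  have h : ∃ y, Tendsto (fun n => M.backPoint x n σ) atTop (𝓝 y) := ⟨_, tendsto_coding hσ⟩
  rw [pastCoding, dif_pos h]
  exact tendsto_nhds_unique h.choose_spec (tendsto_coding hσ)

/-- The approximants of F(σ) stay inside K_{i(e)}, so w_e may be applied along them and the limit
taken through its continuous extension. The argument also shows that the shifted path stays in `D`.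
-/
theorem coding_shift [CompleteSpace K] (hM : M.IsUniformlyContinuous) (hx : ∀ j, x j ∈ M.cell j) {e : E}
    {σ : CodeSpace E} (hσ : σ ∈ M.D x) (he : σ 1 = (e : OnePoint E)) :
    M.coding x (CodeSpace.shift σ) = M.wBar e (M.coding x σ) := by
  have ht : M.tExt (σ 0) = M.i e := by
    rw [← iExt_one_eq hσ.1, he]
    rfl
  have hcl : M.coding x σ ∈ closure (M.cell (M.i e)) := ht ▸ coding_mem_closure hx hσ
  have hlim : Tendsto (fun n => M.backPoint x (n + 1) (CodeSpace.shift σ)) atTop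
      (𝓝 (M.wBar e (M.coding x σ))) := by
    have hw : Tendsto (M.w e) (𝓝[M.cell (M.i e)] M.coding x σ)
        (𝓝 (M.wBar e (M.coding x σ))) :=
      tendsto_extendFrom ((hM e).1.exists_tendsto_nhdsWithin hcl)
    have hb : Tendsto (fun n => M.backPoint x n σ) atTop
        (𝓝[M.cell (M.i e)] M.coding x σ) :=
      tendsto_nhdsWithin_iff.2 ⟨tendsto_coding hσ,
        Eventually.of_forall fun n => ht ▸ backPoint_mem hx hσ.1 n⟩
    refine (hw.comp hb).congr fun n => ?_
    rw [backPoint_shift, he]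
    rfl
  have hlim' := (tendsto_add_atTop_iff_nat
    (f := fun n => M.backPoint x n (CodeSpace.shift σ)) 1).1 hlim
  have hS : CodeSpace.shift σ ∈ M.D x := ⟨pathSpace_shift hσ.1, _, hlim'⟩
  exact tendsto_nhds_unique (tendsto_coding hS) hlim'

variable [BorelSpace K]

theorem measurable_pBdry (hM : M.IsUniformlyContinuous) (e : E) : Measurable (M.pBdry e) := by
  have h : Measurable (M.pBar e) :=
    Measurable.indicator_comp_of_restrict isClosed_closure.measurableSet
      (continuousOn_iff_continuous_domRestrict.1
        (hM e).2.continuousOn_extendFrom_closure).measurable measurable_id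
  exact h.indicator (isClosed_closure.measurableSet.diff (M.cell_measurable _))

variable [CompleteSpace K]

theorem measurable_indicator_wBar (hM : M.IsUniformlyContinuous) (e : E) {f : K → ℝ≥0∞}
    (hf : Measurable f) :
    Measurable ((closure (M.cell (M.i e))).indicator fun y => f (M.wBar e y)) :=
  Measurable.indicator_comp_of_restrict isClosed_closure.measurableSet
    (continuousOn_iff_continuous_domRestrict.1
      (hM e).1.continuousOn_extendFrom_closure).measurable hf

theorem measurable_R [Countable E] (hM : M.IsUniformlyContinuous) {f : K → ℝ≥0∞}
    (hf : Measurable f) : Measurable (M.R f) := by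
  have h : M.R f = fun y => ∑' e, ENNReal.ofReal (M.pBdry e y) *
      (closure (M.cell (M.i e))).indicator (fun y => f (M.wBar e y)) y := by
    funext y
    refine tsum_congr fun e => ?_
    by_cases hy : y ∈ closure (M.cell (M.i e))
    · rw [indicator_of_mem hy]
    · rw [pBdry, indicator_of_notMem fun h => hy h.1]
      simp
  rw [h]
  exact Measurable.tsum fun e =>
    (measurable_pBdry hM e).ennreal_ofReal.mul (measurable_indicator_wBar hM e hf)

theorem measurable_pastCoding [Countable E] : Measurable[CodeSpace.past E] (M.pastCoding x) :=
  @measurable_dite_tendsto _ _ (CodeSpace.past E) _ _ _ _ (M.backPoint x)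
    (fun n => CodeSpace.measurable_past_of_dependsOn n fun _ _ h => backPoint_congr h)
    measurable_dist_backPoint _

/-- `D` also constrains future coordinates, so past-measurability is available for `pastCoding` and
is transferred almost everywhere. -/
theorem aemeasurable_coding [Countable E] {Λ : Measure (CodeSpace E)}
    (hD : ∀ᵐ σ ∂Λ, σ ∈ M.D x) : AEMeasurable (M.coding x) Λ :=
  ⟨M.pastCoding x, measurable_pastCoding.mono CodeSpace.past_le le_rfl,
    hD.mono fun _ hσ => (pastCoding_eq hσ).symm⟩

end Metric

end MarkovSystem

/-! ### The interior event -/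

namespace MarkovSystem

section Interior

variable {K E : Type*} [MetricSpace K] [MeasurableSpace K] {M : MarkovSystem K E} {x : M.N → K}

/-- The event that the coded point lies in the vertex set that the path has reached. -/
def interiorEvent (M : MarkovSystem K E) (x : M.N → K) : Set (CodeSpace E) := {σ | M.pastCoding x σ ∈ M.cell (M.tExt (σ 0))}

theorem mem_interiorEvent_iff {σ : CodeSpace E} (hσ : σ ∈ M.D x) :
    σ ∈ M.interiorEvent x ↔ M.coding x σ ∈ M.cell (M.tExt (σ 0)) := by
  rw [← pastCoding_eq hσ]
  rfl

theorem ae_mem_D [CompleteSpace K] [Countable E] {Λ : Measure (CodeSpace E)}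
    [IsProbabilityMeasure Λ] (hD : Λ (M.D x) = 1) : ∀ᵐ σ ∂Λ, σ ∈ M.D x :=
  (mem_ae_iff_prob_eq_one measurableSet_D).2 hD

end Interior

/-! ### Asymptotic states and their decomposition along the interior event -/

section States

variable {K E : Type*} [MetricSpace K] [CompleteSpace K] [MeasurableSpace K] [BorelSpace K]
  [Countable E] {M : MarkovSystem K E} {x : M.N → K} {Λ : Measure (CodeSpace E)}

/-- One step of the coded process, conditionally on the past. -/
theorem setLIntegral_coding_shift (hM : M.IsUniformlyContinuous) (hx : ∀ j, x j ∈ M.cell j)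
    [IsProbabilityMeasure Λ] (hD : ∀ᵐ σ ∂Λ, σ ∈ M.D x) {q : E → K → ℝ}
    (hq : ∀ e, condExp (CodeSpace.past E) Λ (CodeSpace.indOne e) =ᵐ[Λ]
      (M.T (M.i e)).indicator fun σ => q e (M.coding x σ))
    {s : Set (CodeSpace E)} (hs : MeasurableSet[CodeSpace.past E] s) {f : K → ℝ≥0∞}
    (hf : Measurable f) :
    ∫⁻ σ in s, f (M.coding x (CodeSpace.shift σ)) ∂Λ =
      ∫⁻ σ in s, ∑' e, (M.T (M.i e)).indicator
        (fun σ => ENNReal.ofReal (q e (M.coding x σ)) * f (M.wBar e (M.coding x σ))) σ ∂Λ := by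
  have hs' := CodeSpace.past_le _ hs
  -- A past-measurable form of the integrand, as the pull-out property requires. On `D` with t(σ_0)
  -- = i(e) the closure indicator equals 1.
  let h : E → CodeSpace E → ℝ≥0∞ := fun e => s.indicator fun σ =>
    (closure (M.cell (M.i e))).indicator (fun y => f (M.wBar e y)) (M.pastCoding x σ)
  have hh : ∀ e, Measurable[CodeSpace.past E] (h e) := fun e =>
    Measurable.indicator ((measurable_indicator_wBar hM e hf).comp measurable_pastCoding) hs
  have hh' : ∀ e, Measurable (h e) := fun e => (hh e).mono CodeSpace.past_le le_rfl
  let A : E → Set (CodeSpace E) := fun e => {σ | σ 1 = (e : OnePoint E)}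
  have hA : ∀ e, MeasurableSet (A e) := fun e => CodeSpace.measurableSet_apply_eq _ _
  have key : ∀ {e σ}, σ ∈ M.D x → M.tExt (σ 0) = M.i e →
      h e σ = s.indicator (fun σ => f (M.wBar e (M.coding x σ))) σ := by
    intro e σ hσ ht
    have hcl : M.coding x σ ∈ closure (M.cell (M.i e)) := ht ▸ coding_mem_closure hx hσ
    by_cases hσs : σ ∈ s
    · simp only [h, indicator_of_mem hσs, pastCoding_eq hσ, indicator_of_mem hcl]
    · simp only [h, indicator_of_notMem hσs]
  calc ∫⁻ σ in s, f (M.coding x (CodeSpace.shift σ)) ∂Λ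
      = ∫⁻ σ, ∑' e, (A e).indicator (h e) σ ∂Λ := by
        rw [← lintegral_indicator hs']
        refine lintegral_congr_ae (hD.mono fun σ hσ => ?_)
        obtain ⟨e, he, ht⟩ := exists_apply_one_eq hσ.1
        have h1 : ∑' e', (A e').indicator (h e') σ = (A e).indicator (h e) σ := by
          refine tsum_eq_single e fun e' he' => indicator_of_notMem (fun hmem => he' ?_) _
          exact OnePoint.coe_injective ((show σ 1 = (e' : OnePoint E) from hmem).symm.trans he)
        have h2 : σ ∈ A e := he
        simp only [h1, indicator_of_mem h2, key hσ ht]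
        by_cases hσs : σ ∈ s
        · simp only [indicator_of_mem hσs, coding_shift hM hx hσ he]
        · simp only [indicator_of_notMem hσs]
    _ = ∑' e, ∫⁻ σ in A e, h e σ ∂Λ := by
        rw [lintegral_tsum fun e => ((hh' e).indicator (hA e)).aemeasurable]
        exact tsum_congr fun e => lintegral_indicator (hA e) _
    _ = ∑' e, ∫⁻ σ, ENNReal.ofReal (condExp (CodeSpace.past E) Λ (CodeSpace.indOne e) σ) *
          h e σ ∂Λ :=
        tsum_congr fun e =>
          setLIntegral_eq_lintegral_condExp_indicator CodeSpace.past_le Λ (hA e) (hh e)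
    _ = ∫⁻ σ, ∑' e, ENNReal.ofReal (condExp (CodeSpace.past E) Λ (CodeSpace.indOne e) σ) *
          h e σ ∂Λ := by
        refine (lintegral_tsum fun e => ?_).symm
        have : Measurable (condExp (CodeSpace.past E) Λ (CodeSpace.indOne e)) :=
          stronglyMeasurable_condExp.measurable.mono CodeSpace.past_le le_rfl
        exact (this.ennreal_ofReal.mul (hh' e)).aemeasurable
    _ = _ := by
        rw [← lintegral_indicator hs']
        refine lintegral_congr_ae ?_
        filter_upwards [hD, ae_all_iff.2 hq] with σ hσ hqσ
        have h3 : ∀ e, ENNReal.ofReal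
            (condExp (CodeSpace.past E) Λ (CodeSpace.indOne e) σ) * h e σ =
            s.indicator ((M.T (M.i e)).indicator fun σ =>
              ENNReal.ofReal (q e (M.coding x σ)) * f (M.wBar e (M.coding x σ))) σ := by
          intro e
          rw [hqσ e]
          by_cases hT : σ ∈ M.T (M.i e)
          · rw [indicator_of_mem hT, key hσ hT.2]
            by_cases hσs : σ ∈ s
            · simp only [indicator_of_mem hσs, indicator_of_mem hT]
            · simp only [indicator_of_notMem hσs, mul_zero]
          · rw [indicator_of_notMem hT, ENNReal.ofReal_zero, zero_mul]
            by_cases hσs : σ ∈ s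
            · simp only [indicator_of_mem hσs, indicator_of_notMem hT]
            · simp only [indicator_of_notMem hσs]
        simp only [h3]
        by_cases hσs : σ ∈ s
        · simp only [indicator_of_mem hσs]
        · simp only [indicator_of_notMem hσs, tsum_zero]

theorem measurableSet_interiorEvent : MeasurableSet[CodeSpace.past E] (M.interiorEvent x) := by
  have : M.interiorEvent x = ⋃ j, ((fun σ : CodeSpace E => σ 0) ⁻¹' {a | M.tExt a = j} ∩
      M.pastCoding x ⁻¹' M.cell j) := by
    ext σ
    simp only [mem_iUnion]
    exact ⟨fun h => ⟨_, rfl, h⟩, fun ⟨j, (hj : M.tExt (σ 0) = j), h⟩ => by subst hj; exact h⟩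
  rw [this]
  exact @MeasurableSet.iUnion _ _ (CodeSpace.past E) _ _ fun j =>
    @MeasurableSet.inter _ (CodeSpace.past E) _ _
      (CodeSpace.measurable_past_apply le_rfl MeasurableSpace.measurableSet_top)
      (measurable_pastCoding (M.cell_measurable j))

/-- Only forward invariance is checked pointwise, from w_e(K_{i(e)}) ⊆ K_{t(e)}; equality of the
measures upgrades the inclusion. -/
theorem preimage_shift_interiorEvent (hM : M.IsUniformlyContinuous) (hx : ∀ j, x j ∈ M.cell j)
    (hΛ : Λ ∈ CodeSpace.invariantProb E) (hD : Λ (M.D x) = 1) :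
    CodeSpace.shift ⁻¹' M.interiorEvent x =ᵐ[Λ] M.interiorEvent x := by
  have := hΛ.1
  have hD' := ae_mem_D hD
  have hA : MeasurableSet (M.interiorEvent x) := CodeSpace.past_le _ measurableSet_interiorEvent
  refine (ae_eq_of_ae_subset_of_measure_ge ?_ (hΛ.2.measure_preimage hA.nullMeasurableSet).le
    hA.nullMeasurableSet (measure_ne_top _ _)).symm
  filter_upwards [hD', hΛ.2.quasiMeasurePreserving.ae hD'] with σ hσ hSσ hmem
  have hmem : M.coding x σ ∈ M.cell (M.tExt (σ 0)) := (mem_interiorEvent_iff hσ).1 hmem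
  obtain ⟨e, he, ht⟩ := exists_apply_one_eq hσ.1
  rw [ht] at hmem
  refine (mem_interiorEvent_iff hSσ).2 ?_
  rw [coding_shift hM hx hσ he, wBar_eq hM hmem]
  have : M.tExt (CodeSpace.shift σ 0) = M.t e := by
    simp only [CodeSpace.shift, zero_add, he]
    rfl
  rw [this]
  exact M.w_mapsTo e hmem

theorem setLIntegral_U_interiorEvent (hM : M.IsUniformlyContinuous) (hx : ∀ j, x j ∈ M.cell j)
    (hΛ : Λ ∈ M.asymptoticStates x) {f : K → ℝ≥0∞} (hf : Measurable f) :
    ∫⁻ σ in M.interiorEvent x, M.U f (M.coding x σ) ∂Λ =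
      ∫⁻ σ in M.interiorEvent x, f (M.coding x σ) ∂Λ := by
  obtain ⟨hΛi, hD, hq⟩ := hΛ
  have := hΛi.1
  have hD' := ae_mem_D hD
  have hA : MeasurableSet (M.interiorEvent x) := CodeSpace.past_le _ measurableSet_interiorEvent
  have h1 := setLIntegral_coding_shift hM hx hD' hq (measurableSet_interiorEvent (M := M) (x := x)) hf
  have h2 : ∫⁻ σ in M.interiorEvent x, f (M.coding x (CodeSpace.shift σ)) ∂Λ =
      ∫⁻ σ in M.interiorEvent x, f (M.coding x σ) ∂Λ := by
    have hp : Measurable fun σ => f (M.pastCoding x σ) :=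
      hf.comp (measurable_pastCoding.mono CodeSpace.past_le le_rfl)
    calc ∫⁻ σ in M.interiorEvent x, f (M.coding x (CodeSpace.shift σ)) ∂Λ
        = ∫⁻ σ in CodeSpace.shift ⁻¹' M.interiorEvent x,
            f (M.pastCoding x (CodeSpace.shift σ)) ∂Λ := by
          rw [setLIntegral_congr (preimage_shift_interiorEvent hM hx hΛi hD)]
          exact lintegral_congr_ae (ae_restrict_of_ae
            ((hΛi.2.quasiMeasurePreserving.ae hD').mono fun σ hσ => by
              simp only [pastCoding_eq hσ]))
      _ = ∫⁻ σ in M.interiorEvent x, f (M.pastCoding x σ) ∂Λ :=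
          hΛi.2.setLIntegral_comp_preimage hA hp
      _ = _ := lintegral_congr_ae (ae_restrict_of_ae (hD'.mono fun σ hσ => by
          simp only [pastCoding_eq hσ]))
  rw [← h2, h1]
  refine lintegral_congr_ae ?_
  filter_upwards [ae_restrict_of_ae hD', ae_restrict_mem hA] with σ hσ hmem
  rw [mem_interiorEvent_iff hσ] at hmem
  refine tsum_congr fun e => ?_
  by_cases ht : M.tExt (σ 0) = M.i e
  · have hT : σ ∈ M.T (M.i e) := ⟨hσ.1, ht⟩
    rw [ht] at hmem
    rw [indicator_of_mem hT, pBar_eq hM hmem, wBar_eq hM hmem]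
  · have hT : σ ∉ M.T (M.i e) := fun h => ht h.2
    -- For an edge not leaving t(σ_0), p_e vanishes at F(σ) by disjointness of the cells, so U needs
    -- no indicator of T_{i(e)}.
    rw [indicator_of_notMem hT, M.p_eq_zero e _ fun h => ht (eq_of_mem_cell hmem h)]
    simp

/-- Almost surely, paths of `E_⊥` are coded by points outside the vertex set they reach. -/
theorem measure_interiorEvent_eq_zero (hM : M.IsUniformlyContinuous)
    (hx : ∀ j, x j ∈ M.cell j) (hΛ : Λ ∈ M.Eperp x) : Λ (M.interiorEvent x) = 0 := by
  obtain ⟨hΛi, hD, hq⟩ := hΛ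
  have := hΛi.1
  have hD' := ae_mem_D hD
  have hA : MeasurableSet (M.interiorEvent x) := CodeSpace.past_le _ measurableSet_interiorEvent
  -- With f = 1 the left side is the mass of the event, while on the event every boundary weight on
  -- the right vanishes.
  have h1 := setLIntegral_coding_shift hM hx hD' hq (measurableSet_interiorEvent (M := M) (x := x))
    (f := fun _ => 1) measurable_const
  rw [setLIntegral_one] at h1
  rw [h1, ← lintegral_zero (μ := Λ.restrict (M.interiorEvent x))]
  refine lintegral_congr_ae ?_
  filter_upwards [ae_restrict_of_ae hD', ae_restrict_mem hA] with σ hσ hmem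
  rw [mem_interiorEvent_iff hσ] at hmem
  refine ENNReal.tsum_eq_zero.2 fun e => ?_
  refine indicator_apply_eq_zero.2 fun hT => ?_
  rw [pBdry_eq_zero (hT.2 ▸ hmem)]
  simp

theorem Eperp_subset_asymptoticStates (hM : M.IsUniformlyContinuous)
    (hx : ∀ j, x j ∈ M.cell j) : M.Eperp x ⊆ M.asymptoticStates x := by
  intro Λ hΛ
  have h0 := measure_interiorEvent_eq_zero hM hx hΛ
  obtain ⟨hΛi, hD, hq⟩ := hΛ
  have := hΛi.1
  refine ⟨hΛi, hD, fun e => (hq e).trans ?_⟩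
  filter_upwards [ae_mem_D hD, measure_eq_zero_iff_ae_notMem.1 h0] with σ hσ hmem
  by_cases hT : σ ∈ M.T (M.i e)
  · rw [indicator_of_mem hT, indicator_of_mem hT]
    refine pBdry_eq_pBar fun h => hmem ?_
    rw [mem_interiorEvent_iff hσ, hT.2]
    exact h
  · rw [indicator_of_notMem hT, indicator_of_notMem hT]

/-- Conditioning an asymptotic state on the complement of the interior event. -/
theorem smul_restrict_mem_Eperp (hM : M.IsUniformlyContinuous) (hx : ∀ j, x j ∈ M.cell j)
    (hΛ : Λ ∈ M.asymptoticStates x) (h0 : Λ (M.interiorEvent x)ᶜ ≠ 0) :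
    (Λ (M.interiorEvent x)ᶜ)⁻¹ • Λ.restrict (M.interiorEvent x)ᶜ ∈ M.Eperp x := by
  obtain ⟨hΛi, hD, hq⟩ := hΛ
  have := hΛi.1
  have hB : MeasurableSet[CodeSpace.past E] (M.interiorEvent x)ᶜ :=
    MeasurableSet.compl measurableSet_interiorEvent
  have hB' := CodeSpace.past_le _ hB
  have hinv := preimage_shift_interiorEvent hM hx hΛi hD
  set B := (M.interiorEvent x)ᶜ with hBdef
  have hprob : IsProbabilityMeasure ((Λ B)⁻¹ • Λ.restrict B) := ⟨by
    simp [ENNReal.inv_mul_cancel h0 (measure_ne_top _ _)]⟩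
  have hac : (Λ B)⁻¹ • Λ.restrict B ≪ Λ :=
    Measure.smul_absolutelyContinuous.trans Measure.absolutelyContinuous_restrict
  have hmemB : ∀ᵐ σ ∂((Λ B)⁻¹ • Λ.restrict B), σ ∈ B :=
    Measure.smul_absolutelyContinuous.ae_le (ae_restrict_mem hB')
  have hDB := hac.ae_le (ae_mem_D hD)
  refine ⟨⟨hprob, ?_⟩, (mem_ae_iff_prob_eq_one measurableSet_D).1 hDB, fun e => ?_⟩
  -- Almost sure invariance of `B` makes the restricted measure shift-invariant.
  · have h := hΛi.2.restrict_preimage hB'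
    have hinvB : CodeSpace.shift ⁻¹' B =ᵐ[Λ] B := hinv.compl
    rw [Measure.restrict_congr_set hinvB] at h
    exact h.smul_measure _
  · refine (condExp_smul_restrict_ae_eq CodeSpace.past_le Λ hB (ENNReal.inv_ne_top.2 h0)
      (CodeSpace.integrable_indOne Λ e)).trans ((hac.ae_eq (hq e)).trans ?_)
    filter_upwards [hDB, hmemB] with σ hσ hmem
    by_cases hT : σ ∈ M.T (M.i e)
    · rw [indicator_of_mem hT, indicator_of_mem hT]
      refine (pBdry_eq_pBar fun h => hmem ?_).symm
      rw [mem_interiorEvent_iff hσ, hT.2]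
      exact h
    · rw [indicator_of_notMem hT, indicator_of_notMem hT]

theorem map_coding_mem_invariantMeasures_iff [IsProbabilityMeasure Λ]
    (hD : ∀ᵐ σ ∂Λ, σ ∈ M.D x) :
    Measure.map (M.coding x) Λ ∈ M.invariantMeasures ↔
      ∀ f : K → ℝ≥0, Measurable f → (∃ C, ∀ y, f y ≤ C) →
        ∫⁻ σ, M.U (fun z => (f z : ℝ≥0∞)) (M.coding x σ) ∂Λ =
          ∫⁻ σ, (f (M.coding x σ) : ℝ≥0∞) ∂Λ := by
  have hF := aemeasurable_coding hD
  have hp := Measure.isProbabilityMeasure_map hF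
  have hmap : ∀ {g : K → ℝ≥0∞}, Measurable g →
      ∫⁻ y, g y ∂(Measure.map (M.coding x) Λ) = ∫⁻ σ, g (M.coding x σ) ∂Λ :=
    fun hg => lintegral_map' hg.aemeasurable hF
  constructor
  · rintro ⟨-, h⟩ f hf hb
    rw [← hmap (measurable_U hf.coe_nnreal_ennreal), ← hmap hf.coe_nnreal_ennreal]
    exact h f hf hb
  · refine fun h => ⟨hp, fun f hf hb => ?_⟩
    rw [hmap (measurable_U hf.coe_nnreal_ennreal), hmap hf.coe_nnreal_ennreal]
    exact h f hf hb

theorem isConsistent_iff_forall_mem_Eperp (hM : M.IsUniformlyContinuous)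
    (hx : ∀ j, x j ∈ M.cell j) :
    M.IsConsistent x ↔
      ∀ Λ ∈ M.Eperp x, Measure.map (M.coding x) Λ ∈ M.invariantMeasures := by
  refine ⟨fun h Λ hΛ => h Λ (Eperp_subset_asymptoticStates hM hx hΛ), fun h Λ hΛ => ?_⟩
  have := hΛ.1.1
  refine (map_coding_mem_invariantMeasures_iff (ae_mem_D hΛ.2.1)).2 fun f hf hb => ?_
  have hA : MeasurableSet (M.interiorEvent x) := CodeSpace.past_le _ measurableSet_interiorEvent
  rw [← lintegral_add_compl _ hA, ← lintegral_add_compl (fun σ => (f (M.coding x σ) : ℝ≥0∞)) hA,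
    setLIntegral_U_interiorEvent hM hx hΛ hf.coe_nnreal_ennreal]
  congr 1
  -- The interior parts agree unconditionally. The rest is null, or is a multiple of a state in E_⊥
  -- and the normalising factor cancels.
  by_cases h0 : Λ (M.interiorEvent x)ᶜ = 0
  · rw [setLIntegral_measure_zero _ _ h0, setLIntegral_measure_zero _ _ h0]
  have hB := smul_restrict_mem_Eperp hM hx hΛ h0
  have := hB.1.1
  have h1 := (map_coding_mem_invariantMeasures_iff (ae_mem_D hB.2.1)).1 (h _ hB) f hf hb
  rw [lintegral_smul_measure, lintegral_smul_measure] at h1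
  exact (ENNReal.mul_right_inj (ENNReal.inv_ne_zero.2 (measure_ne_top _ _))
    (ENNReal.inv_ne_top.2 h0)).1 h1

/-! ### Domination on the boundary -/

theorem measurable_R_iterate_one (hM : M.IsUniformlyContinuous) (n : ℕ) :
    Measurable (M.R^[n] fun _ => 1) := by
  induction n with
  | zero => exact measurable_const
  | succ n ih =>
    rw [Function.iterate_succ_apply']
    exact measurable_R hM ih

/-- Only an inequality: R also counts edges whose cell closure contains F(σ) although they do not
leave t(σ_0). -/
theorem setLIntegral_coding_shift_le_R (hM : M.IsUniformlyContinuous)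
    (hx : ∀ j, x j ∈ M.cell j) (hΛ : Λ ∈ M.Eperp x) {s : Set (CodeSpace E)}
    (hs : MeasurableSet[CodeSpace.past E] s) {f : K → ℝ≥0∞} (hf : Measurable f) :
    ∫⁻ σ in s, f (M.coding x (CodeSpace.shift σ)) ∂Λ ≤
      ∫⁻ σ in s, M.R f (M.coding x σ) ∂Λ := by
  have := hΛ.1.1
  rw [setLIntegral_coding_shift hM hx (ae_mem_D hΛ.2.1) hΛ.2.2 hs hf]
  exact lintegral_mono fun σ => ENNReal.tsum_le_tsum fun e =>
    indicator_le_self _ (fun σ => ENNReal.ofReal (M.pBdry e (M.coding x σ)) *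
      f (M.wBar e (M.coding x σ))) σ

/-- Induction on n. By invariance Rⁿ1 ≥ 1 also holds a.e. at F(Sσ), so on every past event the
integral of (Rⁿ⁺¹1)∘F is at least the mass of that event; the event where the integrand is below 1
must be null. -/
theorem ae_coding_mem_Omega (hM : M.IsUniformlyContinuous) (hx : ∀ j, x j ∈ M.cell j)
    (hΛ : Λ ∈ M.Eperp x) : ∀ᵐ σ ∂Λ, M.coding x σ ∈ M.Omega := by
  have := hΛ.1.1
  have hD := ae_mem_D hΛ.2.1
  have main : ∀ n, ∀ᵐ σ ∂Λ, 1 ≤ (M.R^[n] fun _ => 1) (M.coding x σ) := by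
    intro n
    induction n with
    | zero => exact ae_of_all _ fun _ => le_rfl
    | succ n ih =>
      set g : K → ℝ≥0∞ := M.R^[n + 1] fun _ => 1 with hg
      let s : Set (CodeSpace E) := {σ | g (M.pastCoding x σ) < 1}
      have hs : MeasurableSet[CodeSpace.past E] s :=
        measurable_pastCoding (measurableSet_lt (measurable_R_iterate_one hM (n + 1))
          measurable_const)
      have hle : Λ s ≤ ∫⁻ σ in s, g (M.pastCoding x σ) ∂Λ := by
        calc Λ s = ∫⁻ _ in s, 1 ∂Λ := (setLIntegral_one s).symm
          _ ≤ ∫⁻ σ in s, (M.R^[n] fun _ => 1) (M.coding x (CodeSpace.shift σ)) ∂Λ :=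
              lintegral_mono_ae (ae_restrict_of_ae (hΛ.1.2.quasiMeasurePreserving.ae ih))
          _ ≤ ∫⁻ σ in s, M.R (M.R^[n] fun _ => 1) (M.coding x σ) ∂Λ :=
              setLIntegral_coding_shift_le_R hM hx hΛ hs (measurable_R_iterate_one hM n)
          _ = _ := by
              rw [hg, Function.iterate_succ_apply']
              exact lintegral_congr_ae (ae_restrict_of_ae (hD.mono fun σ hσ => by
                simp only [pastCoding_eq hσ]))
      have h0 : Λ s = 0 := by
        by_contra h0
        refine absurd hle (not_le.2 ?_)
        have hlt := setLIntegral_strict_mono (μ := Λ) (CodeSpace.past_le _ hs) h0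
          (measurable_const (a := (1 : ℝ≥0∞)))
          (f := fun σ => g (M.pastCoding x σ)) ?_ (ae_of_all _ fun σ hσ => hσ)
        · simpa using hlt
        · refine ((setLIntegral_mono' (g := fun _ => 1) (CodeSpace.past_le _ hs)
            fun σ hσ => le_of_lt hσ).trans_lt ?_).ne
          rw [setLIntegral_one]
          exact measure_lt_top _ _
      filter_upwards [hD, measure_eq_zero_iff_ae_notMem.1 h0] with σ hσ hns
      rw [← pastCoding_eq hσ]
      exact not_lt.1 hns
  filter_upwards [ae_all_iff.2 main] with σ hσ
  exact mem_iInter.2 hσ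

theorem isConsistent_of_boundaryDomination (hM : M.BoundaryDomination x)
    (hx : ∀ j, x j ∈ M.cell j) : M.IsConsistent x := by
  refine (isConsistent_iff_forall_mem_Eperp hM.1 hx).2 fun Λ hΛ => ?_
  have := hΛ.1.1
  have hD := ae_mem_D hΛ.2.1
  have hF := aemeasurable_coding hD
  have hle : ∀ f : K → ℝ≥0, Measurable f → (∃ C, ∀ y, f y ≤ C) →
      ∫⁻ σ, (f (M.coding x σ) : ℝ≥0∞) ∂Λ ≤
        ∫⁻ σ, M.U (fun z => (f z : ℝ≥0∞)) (M.coding x σ) ∂Λ := by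
    intro f hf hb
    have hp : Measurable fun σ => (f (M.pastCoding x σ) : ℝ≥0∞) :=
      hf.coe_nnreal_ennreal.comp (measurable_pastCoding.mono CodeSpace.past_le le_rfl)
    calc ∫⁻ σ, (f (M.coding x σ) : ℝ≥0∞) ∂Λ
        = ∫⁻ σ, (f (M.pastCoding x σ) : ℝ≥0∞) ∂Λ :=
          lintegral_congr_ae (hD.mono fun σ hσ => by simp only [pastCoding_eq hσ])
      _ = ∫⁻ σ, (f (M.pastCoding x (CodeSpace.shift σ)) : ℝ≥0∞) ∂Λ :=
          (hΛ.1.2.lintegral_comp hp).symm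
      _ = ∫⁻ σ, (f (M.coding x (CodeSpace.shift σ)) : ℝ≥0∞) ∂Λ :=
          lintegral_congr_ae ((hΛ.1.2.quasiMeasurePreserving.ae hD).mono fun σ hσ => by
            simp only [pastCoding_eq hσ])
      _ ≤ ∫⁻ σ, M.R (fun z => (f z : ℝ≥0∞)) (M.coding x σ) ∂Λ := by
          simpa using setLIntegral_coding_shift_le_R hM.1 hx hΛ
            (@MeasurableSet.univ _ (CodeSpace.past E)) hf.coe_nnreal_ennreal
      _ ≤ _ := lintegral_mono_ae ((ae_coding_mem_Omega hM.1 hx hΛ).mono fun σ hσ =>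
          hM.2 f hf hb σ hσ)
  refine (map_coding_mem_invariantMeasures_iff hD).2 fun f hf ⟨C, hC⟩ => ?_
  have h1 := hle f hf ⟨C, hC⟩
  -- The inequality for f and for C - f adds up to C ≤ C, since U fixes constants; hence both are
  -- equalities.
  have h2 := hle (fun y => C - f y) (measurable_const.sub hf) ⟨C, fun y => tsub_le_self⟩
  have hsum : ∀ y, (f y : ℝ≥0∞) + ((C - f y : ℝ≥0) : ℝ≥0∞) = C := fun y => by
    rw [← ENNReal.coe_add, add_tsub_cancel_of_le (hC y)]
  have h3 : ∫⁻ σ, (f (M.coding x σ) : ℝ≥0∞) ∂Λ +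
      ∫⁻ σ, ((C - f (M.coding x σ) : ℝ≥0) : ℝ≥0∞) ∂Λ = C := by
    have hm : AEMeasurable (fun σ => (f (M.coding x σ) : ℝ≥0∞)) Λ :=
      hf.coe_nnreal_ennreal.comp_aemeasurable hF
    rw [← lintegral_add_left' hm, lintegral_congr fun σ => hsum (M.coding x σ)]
    simp
  have h4 : ∫⁻ σ, M.U (fun z => (f z : ℝ≥0∞)) (M.coding x σ) ∂Λ +
      ∫⁻ σ, M.U (fun z => ((C - f z : ℝ≥0) : ℝ≥0∞)) (M.coding x σ) ∂Λ = C := by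
    have hm : AEMeasurable (fun σ => M.U (fun z => (f z : ℝ≥0∞)) (M.coding x σ)) Λ :=
      (measurable_U hf.coe_nnreal_ennreal).comp_aemeasurable hF
    rw [← lintegral_add_left' hm]
    simp only [← U_add, hsum, U_const]
    simp
  refine le_antisymm ?_ h1
  -- Finiteness permits cancellation in `ℝ≥0∞`.
  have hfin : ∫⁻ σ, ((C - f (M.coding x σ) : ℝ≥0) : ℝ≥0∞) ∂Λ ≠ ∞ := fun h => by
    rw [h, add_top] at h3
    exact ENNReal.coe_ne_top h3.symm
  refine (ENNReal.add_le_add_iff_right hfin).1 ?_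
  rw [h3, ← h4]
  gcongr

end States

end MarkovSystem

theorem theorem3 {K : Type*} [MetricSpace K] [CompleteSpace K] [MeasurableSpace K] [BorelSpace K]
    {E : Type*} [Countable E] (M : MarkovSystem K E)
    (x : M.N → K) (hx : ∀ j, x j ∈ M.cell j) :
    (M.IsUniformlyContinuous →
      (M.IsConsistent x ↔
        ∀ Λ ∈ M.Eperp x, Measure.map (M.coding x) Λ ∈ M.invariantMeasures)) ∧
    (M.BoundaryDomination x → M.IsConsistent x) :=
  ⟨fun hM => MarkovSystem.isConsistent_iff_forall_mem_Eperp hM hx,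
    fun hM => MarkovSystem.isConsistent_of_boundaryDomination hM hx⟩
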